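/- Let $1\le d<K$ and $D$ be integers. For a real $K\times D$ matrix $X$ let $\lambda_1(X)\ge\lambda_2(X)\ge\dots\ge\lambda_K(X)\ge 0$ be its singular values (with $\lambda_j(X)=0$ for $D<j\le K$), and let $X=ULV'$ be a singular value decomposition, with $U=(u_1,\dots,u_K)$ and $V$ orthogonal matrices of sizes $K\times K$ and $D\times D$, and $L$ the $K\times D$ matrix that has the singular values, in decreasing order, on its diagonal and zeros elsewhere. Put $U_1=(u_1,\dots,u_d)$, and let $\mathbf 1\in\mathbb R^K$ be the vector of ones. A weight vector of $X$ (with respect to its $d$-dimensional representation) is a vector $$w\in\operatorname*{argmin}\bigl\{\|v\|^2 : v\in\operatorname{span}\{u_{d+1},\dots,u_K\},\ v'\mathbf 1=1\bigr\}$$ for a singular value decomposition of $X$, where $\|\cdot\|$ is the Euclidean norm. **Theorem.** Let $X_i$ be a real $K\times D$ matrix (the neighborhood matrix of a point $x_i\in\mathbb R^D$ with $K$ neighbors $\eta_j$, whose rows are $\eta_j-x_i$), with singular values $\lambda_j=\lambda_j(X_i)$ and singular value decomposition $X_i=ULV'$. Let $E_i$ be a real $K\times D$ matrix with $\|E_i\|_F=1$,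 and let $\widetilde X_i=X_i+\varepsilon E_i$ with $\varepsilon>0$. Assume * (A1) $\lambda_{d+1}<\min\{\lambda_d^2,\ \lambda_d/72\}$; * (A2) $\frac1K\mathbf 1'U_1U_1'\mathbf 1<\alpha$ for a real number $\alpha<1$; * $\lambda_1<1$ and $\varepsilon<\min\left(\frac{\lambda_d^4}{72},\ \frac{\lambda_d^2(1-\alpha)}{72}\right)$. Then $X_i$ and $\widetilde X_i$ have unique weight vectors $w_i$ and $\tilde w_i$ (independent of the choice of the singular value decomposition), and $$\|w_i-\tilde w_i\|<\frac{20\,\varepsilon}{\lambda_d^2(1-\alpha)}.$$ -/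

import Mathlib

open scoped Matrix

-- The norm of a matrix is the Frobenius norm.
attribute [local instance] Matrix.frobeniusNormedAddCommGroup

/-- The sequence of singular values of a real `K × D` matrix, from the largest to the lowest.
It is zero-indexed (`singularValue X 0` is the largest singular value) and continued by zeros. -/
noncomputable def singularValue {K D : ℕ} (X : Matrix (Fin K) (Fin D) ℝ) (j : ℕ) : ℝ :=
  (Matrix.toEuclideanLin X).singularValues j

/-- The rectangular `K × D` matrix with entries `s 0, s 1, …` on the main diagonal
and zeros elsewhere. -/
def rectDiagonal (K D : ℕ) (s : ℕ → ℝ) : Matrix (Fin K) (Fin D) ℝ :=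
  Matrix.of fun i j => if i.val = j.val then s i.val else 0

/-- `X = U L Vᵀ` is a (full) singular value decomposition of `X`: `U` and `V` are orthogonal, and
`L` carries the singular values of `X`, in decreasing order, on its diagonal. -/
structure IsSVD {K D : ℕ} (X : Matrix (Fin K) (Fin D) ℝ) (U : Matrix (Fin K) (Fin K) ℝ)
    (V : Matrix (Fin D) (Fin D) ℝ) : Prop where
  left_orthogonal : U ∈ Matrix.orthogonalGroup (Fin K) ℝ
  right_orthogonal : V ∈ Matrix.orthogonalGroup (Fin D) ℝ
  eq_mul : X = U * rectDiagonal K D (singularValue X) * Vᵀ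

/-- The matrix `U₁ = (u₁, …, u_d)` of the first `d` columns of `U`. -/
def firstColumns {K d : ℕ} (h : d ≤ K) (U : Matrix (Fin K) (Fin K) ℝ) :
    Matrix (Fin K) (Fin d) ℝ :=
  U.submatrix id (Fin.castLE h)

/-- The span of the columns `u_{d+1}, …, u_K` of `U`, in Euclidean space. -/
noncomputable def lastColumnsSpan {K : ℕ} (d : ℕ) (U : Matrix (Fin K) (Fin K) ℝ) :
    Submodule ℝ (EuclideanSpace ℝ (Fin K)) :=
  Submodule.span ℝ ((fun j : Fin K => WithLp.toLp 2 (U.col j)) '' {j | d ≤ j.val})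

/-- The vectors in `span {u_{d+1}, …, u_K}` whose entries sum to one. -/
def admissibleWeights {K : ℕ} (d : ℕ) (U : Matrix (Fin K) (Fin K) ℝ) :
    Set (EuclideanSpace ℝ (Fin K)) :=
  {w | w ∈ lastColumnsSpan d U ∧ ∑ j, w j = 1}

/-- `w` is a weight vector of the neighborhood matrix `X` with respect to its `d`-dimensional
representation: for a singular value decomposition `X = U L Vᵀ`, it has the smallest Euclidean
norm among all vectors in the span of the last `K - d` columns of `U` whose entries sum to one. -/
def IsWeightVector {K D : ℕ} (d : ℕ) (X : Matrix (Fin K) (Fin D) ℝ)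
    (w : EuclideanSpace ℝ (Fin K)) : Prop :=
  ∃ (U : Matrix (Fin K) (Fin K) ℝ) (V : Matrix (Fin D) (Fin D) ℝ), IsSVD X U V ∧
    w ∈ admissibleWeights d U ∧ IsMinOn (fun v => ‖v‖ ^ 2) (admissibleWeights d U) w

/-! Write $e=\mathbf 1$ and let $P$ be the orthogonal projection onto the span of the last $K-d$
left singular vectors. The weight vector is $Pe/\|Pe\|^2$, so everything depends on how $P$ moves
when $X$ is perturbed. The columns of $U$ are eigenvectors of $XX'$ with eigenvalues $\lambda_j^2$,
and the perturbation changes $XX'$ by at most $2\varepsilon\lambda_1+\varepsilon^2\le 3\varepsilon$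
in operator norm. Weyl's inequality (`le_add_norm_sub`) keeps the gap between the $d$-th and
$(d+1)$-th eigenvalues of order $\lambda_d^2$, and Davis–Kahan (`norm_starProjection_sub_le`) turns
this into $\|P-\widetilde P\|=O(\varepsilon/\lambda_d^2)$. With equal matrices the same bound shows
that the span does not depend on the decomposition. By (A2), $\|Pe\|^2\ge(1-\alpha)K$. Since
$x\mapsto x/\|x\|^2$ is an inversion, distances get divided by $\|Pe\|\,\|\widetilde Pe\|$, which
contributes the factor $1/(1-\alpha)$ (`norm_minNormVector_sub_le`). -/

/-! ### Spectral subspaces: the Weyl and Davis–Kahan inequalities -/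

section TailSpan

open scoped InnerProductSpace

variable {H : Type*} [NormedAddCommGroup H] [InnerProductSpace ℝ H] {n : ℕ}

/-- The span of the vectors of an orthonormal basis with index at least `d`. -/
noncomputable def tailSpan (b : OrthonormalBasis (Fin n) ℝ H) (d : ℕ) : Submodule ℝ H :=
  Submodule.span ℝ (b '' {j | d ≤ j.val})

instance (b : OrthonormalBasis (Fin n) ℝ H) (d : ℕ) : FiniteDimensional ℝ (tailSpan b d) :=
  FiniteDimensional.span_of_finite ℝ (Set.toFinite _)

theorem mem_tailSpan_iff (b : OrthonormalBasis (Fin n) ℝ H) {d : ℕ} {x : H} :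
    x ∈ tailSpan b d ↔ ∀ j : Fin n, j.val < d → b.repr x j = 0 := by
  have h := b.toBasis.mem_span_image (m := x) (s := {j : Fin n | d ≤ j.val})
  rw [OrthonormalBasis.coe_toBasis] at h
  rw [tailSpan, h]
  constructor
  · intro h j hj
    by_contra hne
    have : d ≤ j.val := h (Finsupp.mem_support_iff.2 hne)
    omega
  · intro h j hj
    by_contra hne
    exact Finsupp.mem_support_iff.1 hj (h j (not_le.1 hne))

theorem mem_tailSpan_orthogonal_iff (b : OrthonormalBasis (Fin n) ℝ H) {d : ℕ} {x : H} :
    x ∈ (tailSpan b d)ᗮ ↔ ∀ j : Fin n, d ≤ j.val → b.repr x j = 0 := by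
  constructor
  · intro h j hj
    rw [b.repr_apply_apply]
    exact h _ (Submodule.subset_span ⟨j, hj, rfl⟩)
  · intro h y hy
    rw [mem_tailSpan_iff] at hy
    rw [← b.repr.inner_map_map, PiLp.inner_apply]
    refine Finset.sum_eq_zero fun j _ => ?_
    rcases lt_or_ge j.val d with hj | hj
    · simp [hy j hj]
    · simp [h j hj]

theorem finrank_tailSpan (b : OrthonormalBasis (Fin n) ℝ H) (d : ℕ) :
    Module.finrank ℝ (tailSpan b d) = n - d := by
  rw [tailSpan, ← Set.range_domRestrict, finrank_span_eq_card]
  · rw [Fintype.card_subtype]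
    have : (Finset.univ.filter fun j : Fin n => j ∈ {j : Fin n | d ≤ j.val}).card
        = (Finset.Ico d n).card := by
      refine Finset.card_bij (fun j _ => j.val) ?_ ?_ ?_
      · intro j hj; simp at hj ⊢; exact hj
      · intro i _ j _ h; exact Fin.ext h
      · intro k hk
        rw [Finset.mem_Ico] at hk
        exact ⟨⟨k, hk.2⟩, by simpa using hk.1, rfl⟩
    rw [this, Nat.card_Ico]
  · exact b.orthonormal.linearIndependent.comp _ Subtype.val_injective

/-- `b` is an eigenbasis of `A` whose eigenvalues are a nonnegative decreasing sequence. -/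
structure IsSortedEigenbasis (A : H →L[ℝ] H) (b : OrthonormalBasis (Fin n) ℝ H) (μ : ℕ → ℝ) :
    Prop where
  apply_eq : ∀ j, A (b j) = μ j • b j
  antitone : Antitone μ
  nonneg : ∀ j, 0 ≤ μ j

namespace IsSortedEigenbasis

variable {A B : H →L[ℝ] H} {u v : OrthonormalBasis (Fin n) ℝ H} {μ ν : ℕ → ℝ} {d : ℕ}

theorem repr_apply (h : IsSortedEigenbasis A u μ) (x : H) (j : Fin n) :
    u.repr (A x) j = μ j * u.repr x j := by
  conv_lhs => rw [← u.sum_repr x]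
  simp [map_sum, h.apply_eq, u.repr_self, Finset.sum_apply, Pi.single_apply, mul_comm]

theorem norm_apply_le (h : IsSortedEigenbasis A u μ) {x : H} (hx : x ∈ tailSpan u d) :
    ‖A x‖ ≤ μ d * ‖x‖ := by
  rw [mem_tailSpan_iff] at hx
  refine le_of_sq_le_sq ?_ (mul_nonneg (h.nonneg d) (norm_nonneg _))
  rw [← u.repr.norm_map, ← u.repr.norm_map x, mul_pow, EuclideanSpace.norm_sq_eq,
    EuclideanSpace.norm_sq_eq, Finset.mul_sum]
  refine Finset.sum_le_sum fun j _ => ?_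
  rw [h.repr_apply, norm_mul, mul_pow, Real.norm_of_nonneg (h.nonneg j)]
  rcases lt_or_ge j.val d with hj | hj
  · simp [hx j hj]
  · have := h.antitone hj
    have := h.nonneg j
    gcongr

theorem le_norm_apply (h : IsSortedEigenbasis A u μ) {x : H} (hx : x ∈ (tailSpan u (d + 1))ᗮ) :
    μ d * ‖x‖ ≤ ‖A x‖ := by
  rw [mem_tailSpan_orthogonal_iff] at hx
  refine le_of_sq_le_sq ?_ (norm_nonneg _)
  rw [← u.repr.norm_map (A x), ← u.repr.norm_map x, mul_pow, EuclideanSpace.norm_sq_eq,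
    EuclideanSpace.norm_sq_eq, Finset.mul_sum]
  refine Finset.sum_le_sum fun j _ => ?_
  rw [h.repr_apply, norm_mul, mul_pow, Real.norm_of_nonneg (h.nonneg j)]
  rcases lt_or_ge d j.val with hj | hj
  · simp [hx j hj]
  · have := h.antitone hj
    have := h.nonneg d
    gcongr

/-- Weyl's perturbation inequality for eigenvalues. -/
theorem le_add_norm_sub (hA : IsSortedEigenbasis A u μ) (hB : IsSortedEigenbasis B v ν) {k : ℕ}
    (hk : k < n) : ν k ≤ μ k + ‖A - B‖ := by
  have : FiniteDimensional ℝ H := u.toBasis.finiteDimensional_of_finite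
  have hn : Module.finrank ℝ H = n := by simpa using Module.finrank_eq_card_basis u.toBasis
  -- The dimensions $n-k$ and $k+1$ add up to more than $n$, so the two subspaces share a nonzero
  -- vector.
  have hdis : ¬ Disjoint (tailSpan u k) (tailSpan v (k + 1))ᗮ := by
    intro hd
    have h1 := Submodule.finrank_add_finrank_le_of_disjoint hd
    have h2 := (tailSpan v (k + 1)).finrank_add_finrank_orthogonal
    rw [finrank_tailSpan] at h1 h2
    omega
  rw [Submodule.disjoint_def] at hdis
  push Not at hdis
  obtain ⟨x, hxu, hxv, hx⟩ := hdis
  have hx' : 0 < ‖x‖ := norm_pos_iff.2 hx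
  refine le_of_mul_le_mul_right ?_ hx'
  calc ν k * ‖x‖ ≤ ‖B x‖ := hB.le_norm_apply hxv
    _ = ‖A x - (A - B) x‖ := by simp
    _ ≤ ‖A x‖ + ‖(A - B) x‖ := norm_sub_le _ _
    _ ≤ μ k * ‖x‖ + ‖A - B‖ * ‖x‖ := add_le_add (hA.norm_apply_le hxu) ((A - B).le_opNorm x)
    _ = _ := by ring

theorem apply_mem (h : IsSortedEigenbasis A u μ) {x : H} (hx : x ∈ tailSpan u d) :
    A x ∈ tailSpan u d := by
  rw [mem_tailSpan_iff] at hx ⊢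
  intro j hj
  rw [h.repr_apply, hx j hj, mul_zero]

theorem apply_mem_orthogonal (h : IsSortedEigenbasis A u μ) {x : H} (hx : x ∈ (tailSpan u d)ᗮ) :
    A x ∈ (tailSpan u d)ᗮ := by
  rw [mem_tailSpan_orthogonal_iff] at hx ⊢
  intro j hj
  rw [h.repr_apply, hx j hj, mul_zero]

theorem starProjection_apply (h : IsSortedEigenbasis A u μ) (x : H) :
    (tailSpan u d).starProjection (A x) = A ((tailSpan u d).starProjection x) := by
  refine Submodule.eq_starProjection_of_mem_orthogonal' (v := A ((tailSpan u d).starProjection x))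
    (z := A (x - (tailSpan u d).starProjection x)) (h.apply_mem (Submodule.starProjection_apply_mem _ _))
    (h.apply_mem_orthogonal (Submodule.sub_starProjection_mem_orthogonal _)) ?_
  rw [← map_add, add_sub_cancel]

/-- A one-sided Davis–Kahan bound. -/
theorem norm_one_sub_mul_le (hA : IsSortedEigenbasis A u μ) (hB : IsSortedEigenbasis B v ν)
    (hgap : ν (d + 1) < μ d) :
    ‖(1 - (tailSpan u (d + 1)).starProjection) * (tailSpan v (d + 1)).starProjection‖
      ≤ ‖A - B‖ / (μ d - ν (d + 1)) := by
  set P := (tailSpan u (d + 1)).starProjection with hP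
  set R := (tailSpan v (d + 1)).starProjection with hR
  have hR1 : ∀ x, ‖R x‖ ≤ ‖x‖ := fun x => Submodule.norm_starProjection_apply_le _ x
  have hQ1 : ∀ x, ‖x - P x‖ ≤ ‖x‖ := fun x => by
    have := Submodule.norm_starProjection_apply_le (tailSpan u (d + 1))ᗮ x
    rwa [Submodule.starProjection_orthogonal_val] at this
  have hμ : 0 < μ d := (hB.nonneg _).trans_lt hgap
  -- With $Q=1-P$, commutation gives $AQR=Q(A-B)R+(QR)BR$. Here $A$ expands the range of $Q$ by at
  -- least $\mu_d$ and $B$ stretches the range of $R$ by at most $\nu_{d+1}$. The norm $\|QR\|$ thus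
  -- appears on both sides and is absorbed at the end using the gap.
  have key : ‖(1 - P) * R‖ ≤ (‖A - B‖ + ν (d + 1) * ‖(1 - P) * R‖) / μ d := by
    refine ContinuousLinearMap.opNorm_le_bound _ (by have := hB.nonneg (d+1); positivity) fun z => ?_
    rw [div_mul_eq_mul_div, le_div_iff₀ hμ, mul_comm]
    have e1 : A (((1 - P) * R) z) = ((A - B) (R z) - P ((A - B) (R z))) + ((1 - P) * R) (B (R z)) := by
      have h1 : R (B (R z)) = B (R z) := by
        rw [hR, hB.starProjection_apply, ← hR]
        congr 1
        exact Submodule.starProjection_eq_self_iff.2 (Submodule.starProjection_apply_mem _ _)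
      have h2 : A (P (R z)) = P (A (R z)) := (hA.starProjection_apply _).symm
      simp only [mul_apply_eq_comp, sub_apply,
        one_apply_eq_self, map_sub, h1, h2]
      abel
    have hmem : ((1 - P) * R) z ∈ (tailSpan u (d + 1))ᗮ :=
      Submodule.sub_starProjection_mem_orthogonal (K := tailSpan u (d + 1)) (R z)
    calc μ d * ‖((1 - P) * R) z‖ ≤ ‖A (((1 - P) * R) z)‖ := hA.le_norm_apply hmem
      _ ≤ ‖(A - B) (R z) - P ((A - B) (R z))‖ + ‖((1 - P) * R) (B (R z))‖ := by
          rw [e1]; exact norm_add_le _ _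
      _ ≤ ‖A - B‖ * ‖z‖ + ‖(1 - P) * R‖ * (ν (d + 1) * ‖z‖) := by
          have hν := hB.nonneg (d + 1)
          refine add_le_add ((hQ1 _).trans (((A - B).le_opNorm _).trans ?_))
            ((ContinuousLinearMap.le_opNorm _ _).trans ?_)
          · gcongr; exact hR1 z
          · gcongr
            refine (hB.norm_apply_le (Submodule.starProjection_apply_mem _ _)).trans ?_
            gcongr; exact hR1 z
      _ = _ := by ring
  rw [le_div_iff₀ hμ] at key
  rw [le_div_iff₀ (by linarith)]
  linarith

/-- A bound for the difference of two spectral projections (Davis–Kahan). -/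
theorem norm_starProjection_sub_le [CompleteSpace H] (hA : IsSortedEigenbasis A u μ)
    (hB : IsSortedEigenbasis B v ν) {g : ℝ} (hg : 0 < g) (h1 : g ≤ μ d - ν (d + 1))
    (h2 : g ≤ ν d - μ (d + 1)) :
    ‖(tailSpan u (d + 1)).starProjection - (tailSpan v (d + 1)).starProjection‖
      ≤ 2 * ‖A - B‖ / g := by
  have b1 := hA.norm_one_sub_mul_le hB (d := d) (by linarith)
  have b2 := hB.norm_one_sub_mul_le hA (d := d) (by linarith)
  set P := (tailSpan u (d + 1)).starProjection with hP
  set R := (tailSpan v (d + 1)).starProjection with hR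
  have sP : star P = P := isSelfAdjoint_starProjection _
  have sR : star R = R := isSelfAdjoint_starProjection _
  -- This is $P-R=P(1-R)-(1-P)R$; the first term is the adjoint of $(1-R)P$, so the one-sided bound
  -- applies to both terms.
  have e : P - R = star ((1 - R) * P) - (1 - P) * R := by
    rw [star_mul, star_sub, star_one, sP, sR]
    noncomm_ring
  rw [norm_sub_rev B A] at b2
  calc ‖P - R‖ ≤ ‖star ((1 - R) * P)‖ + ‖(1 - P) * R‖ := by rw [e]; exact norm_sub_le _ _
    _ ≤ ‖A - B‖ / g + ‖A - B‖ / g := by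
        rw [ContinuousLinearMap.star_eq_adjoint, LinearIsometryEquiv.norm_map]
        exact add_le_add (b2.trans (by gcongr)) (b1.trans (by gcongr))
    _ = _ := by ring

/-- Davis–Kahan with zero perturbation forces the two projections to coincide. This makes weight
vectors independent of the chosen decomposition. -/
theorem tailSpan_eq [CompleteSpace H] (hA : IsSortedEigenbasis A u μ)
    (hB : IsSortedEigenbasis A v μ) (hgap : μ (d + 1) < μ d) :
    tailSpan u (d + 1) = tailSpan v (d + 1) := by
  have h := hA.norm_starProjection_sub_le hB (sub_pos.2 hgap) le_rfl le_rfl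
  rw [sub_self, norm_zero, mul_zero, zero_div, norm_le_zero_iff, sub_eq_zero] at h
  exact Submodule.starProjection_inj.1 h

end IsSortedEigenbasis

end TailSpan

/-! ### Minimal norm vectors on an affine hyperplane of a subspace -/

section MinimalNorm

open scoped InnerProductSpace

variable {H : Type*} [NormedAddCommGroup H] [InnerProductSpace ℝ H]

/-- The vector of smallest norm in the affine subspace of all `x ∈ N` with `⟪e, x⟫ = 1`. -/
noncomputable def minNormVector (N : Submodule ℝ H) [N.HasOrthogonalProjection] (e : H) : H :=
  (‖N.starProjection e‖ ^ 2)⁻¹ • N.starProjection e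

variable {N : Submodule ℝ H} [N.HasOrthogonalProjection] {e : H}

theorem inner_starProjection_left_of_mem {x : H} (hx : x ∈ N) :
    ⟪N.starProjection e, x⟫_ℝ = ⟪e, x⟫_ℝ := by
  rw [Submodule.inner_starProjection_left_eq_right, Submodule.starProjection_eq_self_iff.2 hx]

theorem minNormVector_mem : minNormVector N e ∈ N :=
  N.smul_mem _ (Submodule.starProjection_apply_mem _ _)

theorem inner_minNormVector (h : N.starProjection e ≠ 0) : ⟪e, minNormVector N e⟫_ℝ = 1 := by
  have : ‖N.starProjection e‖ ≠ 0 := norm_ne_zero_iff.2 h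
  rw [← inner_starProjection_left_of_mem minNormVector_mem, minNormVector, inner_smul_right,
    real_inner_self_eq_norm_sq]
  field_simp

/-- Pythagoras: `minNormVector N e` is a multiple of the projection of $e$, and $x$ differs from it
by a vector of $N$ orthogonal to $e$. Minimality and uniqueness both follow. -/
theorem norm_sq_eq_add_minNormVector (h : N.starProjection e ≠ 0) {x : H} (hx : x ∈ N)
    (h1 : ⟪e, x⟫_ℝ = 1) :
    ‖x‖ ^ 2 = ‖minNormVector N e‖ ^ 2 + ‖x - minNormVector N e‖ ^ 2 := by
  have h2 : ⟪minNormVector N e, x - minNormVector N e⟫_ℝ = 0 := by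
    rw [minNormVector, inner_smul_left, ← minNormVector,
      inner_starProjection_left_of_mem (N.sub_mem hx minNormVector_mem), inner_sub_right,
      inner_minNormVector h, h1, sub_self, mul_zero]
  have h3 := norm_add_sq_real (minNormVector N e) (x - minNormVector N e)
  rw [add_sub_cancel, h2] at h3
  linarith

theorem isMinOn_iff_eq_minNormVector (h : N.starProjection e ≠ 0) {w : H} :
    ((w ∈ N ∧ ⟪e, w⟫_ℝ = 1) ∧ IsMinOn (fun v => ‖v‖ ^ 2) {v | v ∈ N ∧ ⟪e, v⟫_ℝ = 1} w) ↔
      w = minNormVector N e := by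
  constructor
  · rintro ⟨⟨hw, hw1⟩, hmin⟩
    have h1 : ‖w‖ ^ 2 ≤ ‖minNormVector N e‖ ^ 2 :=
      hmin (show minNormVector N e ∈ {v | v ∈ N ∧ ⟪e, v⟫_ℝ = 1} from
        ⟨minNormVector_mem, inner_minNormVector h⟩)
    have h2 := norm_sq_eq_add_minNormVector h hw hw1
    have h3 : ‖w - minNormVector N e‖ ^ 2 = 0 :=
      le_antisymm (by linarith) (sq_nonneg _)
    exact sub_eq_zero.1 (norm_eq_zero.1 (pow_eq_zero_iff two_ne_zero |>.1 h3))
  · rintro rfl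
    refine ⟨⟨minNormVector_mem, inner_minNormVector h⟩, fun x hx => ?_⟩
    have := norm_sq_eq_add_minNormVector h hx.1 hx.2
    have := sq_nonneg ‖x - minNormVector N e‖
    simp only [Set.mem_ofPred_eq]
    linarith

/-- `minNormVector` is the image of the projection of $e$ under inversion in the unit sphere, and
inversion has an exact distance formula. -/
theorem norm_minNormVector_sub {M : Submodule ℝ H} [M.HasOrthogonalProjection]
    (hN : N.starProjection e ≠ 0) (hM : M.starProjection e ≠ 0) :
    ‖minNormVector N e - minNormVector M e‖ =
      ‖N.starProjection e - M.starProjection e‖ /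
        (‖N.starProjection e‖ * ‖M.starProjection e‖) := by
  have h := dist_div_norm_sq_smul hN hM 1
  rw [dist_eq_norm, dist_eq_norm] at h
  simp only [one_div, inv_pow] at h
  rw [minNormVector, minNormVector, h]
  ring

end MinimalNorm

/-! ### Singular value decompositions and the operator $XX'$ -/

section SingularValueDecomposition

variable {K D : ℕ}

theorem exists_orthonormalBasis_eq_col {U : Matrix (Fin K) (Fin K) ℝ}
    (hU : U ∈ Matrix.orthogonalGroup (Fin K) ℝ) :
    ∃ b : OrthonormalBasis (Fin K) ℝ (EuclideanSpace ℝ (Fin K)),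
      ∀ j, b j = WithLp.toLp 2 (U.col j) := by
  have hon : Orthonormal ℝ fun j => (WithLp.toLp 2 (U.col j) : EuclideanSpace ℝ (Fin K)) := by
    rw [orthonormal_iff_ite]
    intro i j
    have h := congrFun (congrFun ((Matrix.mem_orthogonalGroup_iff' (Fin K) ℝ).1 hU) i) j
    rw [Matrix.one_apply] at h
    rw [← h, EuclideanSpace.inner_toLp_toLp]
    simp [Matrix.mul_apply, dotProduct, Matrix.col, mul_comm]
  obtain ⟨b, hb⟩ := (hon.comp _ Subtype.val_injective).exists_orthonormalBasis_extension_of_card_eq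
    (s := Set.univ) (v := fun j => (WithLp.toLp 2 (U.col j) : EuclideanSpace ℝ (Fin K))) (by simp)
  exact ⟨b, fun j => hb j (Set.mem_univ _)⟩

theorem of_orthonormalBasis_mem_orthogonalGroup
    (b : OrthonormalBasis (Fin K) ℝ (EuclideanSpace ℝ (Fin K))) :
    (Matrix.of fun i j => b j i) ∈ Matrix.orthogonalGroup (Fin K) ℝ := by
  rw [Matrix.mem_orthogonalGroup_iff']
  ext i j
  have h := orthonormal_iff_ite.1 b.orthonormal i j
  rw [Matrix.one_apply, ← h, PiLp.inner_apply]
  simp [Matrix.mul_apply, mul_comm]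

theorem singularValue_eq_zero_of_le_left (X : Matrix (Fin K) (Fin D) ℝ) {j : ℕ} (h : K ≤ j) :
    singularValue X j = 0 := by
  rw [singularValue, LinearMap.singularValues_eq_zero_iff_le_finrank_range]
  refine le_trans (Submodule.finrank_le _) ?_
  simpa using h

theorem singularValue_eq_zero_of_le_right (X : Matrix (Fin K) (Fin D) ℝ) {j : ℕ} (h : D ≤ j) :
    singularValue X j = 0 :=
  LinearMap.singularValues_of_finrank_le _ (by simpa using h)

theorem singularValue_nonneg (X : Matrix (Fin K) (Fin D) ℝ) (j : ℕ) : 0 ≤ singularValue X j :=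
  LinearMap.singularValues_nonneg _ _

theorem singularValue_antitone (X : Matrix (Fin K) (Fin D) ℝ) : Antitone (singularValue X) :=
  LinearMap.singularValues_antitone _

/-- Every real matrix has a singular value decomposition. -/
theorem exists_isSVD (X : Matrix (Fin K) (Fin D) ℝ) : ∃ U V, IsSVD X U V := by
  set T := Matrix.toEuclideanLin X with hT
  have hn : Module.finrank ℝ (EuclideanSpace ℝ (Fin D)) = D := by simp
  set v := T.isSymmetric_adjoint_comp_self.eigenvectorBasis hn with hv
  have hinner : ∀ i j, inner ℝ (T (v i)) (T (v j)) =
      if i = j then singularValue X i ^ 2 else 0 := by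
    intro i j
    have h1 := T.isSymmetric_adjoint_comp_self.apply_eigenvectorBasis hn j
    rw [← LinearMap.adjoint_inner_right, ← LinearMap.comp_apply, h1, inner_smul_right,
      orthonormal_iff_ite.1 (OrthonormalBasis.orthonormal _) i j, ← T.sq_singularValues_fin hn]
    split_ifs with hij
    · subst hij; simp [singularValue, hT]
    · simp
  -- The left singular vectors are $Tv_i/\lambda_i$ where $\lambda_i\ne0$, orthonormal by `hinner`,
  -- and are then completed to a basis. The default value $0$ only occurs at indices where the
  -- singular value vanishes, outside `s`.
  let f : Fin K → EuclideanSpace ℝ (Fin K) := fun i =>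
    if h : i.val < D then (singularValue X i)⁻¹ • T (v ⟨i, h⟩) else 0
  let s : Set (Fin K) := {i | singularValue X i ≠ 0}
  have hs : ∀ i ∈ s, i.val < D := fun i hi => by
    by_contra hc
    exact hi (singularValue_eq_zero_of_le_right X (not_lt.1 hc))
  have hon : Orthonormal ℝ (s.domRestrict f) := by
    rw [orthonormal_iff_ite]
    rintro ⟨i, hi⟩ ⟨j, hj⟩
    simp only [Set.domRestrict_apply, f, hs i hi, hs j hj, dif_pos, inner_smul_left,
      inner_smul_right, hinner, Subtype.mk.injEq, Fin.ext_iff]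
    split_ifs with hij
    · have : singularValue X i ≠ 0 := hi
      rw [← hij]
      simp
      field_simp
    · simp
  obtain ⟨b, hb⟩ := hon.exists_orthonormalBasis_extension_of_card_eq (by simp)
  refine ⟨Matrix.of fun i j => b j i, Matrix.of fun i j => v j i,
    of_orthonormalBasis_mem_orthogonalGroup b, of_orthonormalBasis_mem_orthogonalGroup v, ?_⟩
  have hV := (Matrix.mem_orthogonalGroup_iff (Fin D) ℝ).1 (of_orthonormalBasis_mem_orthogonalGroup v)
  have hXV : X * (Matrix.of fun i j => v j i) =
      (Matrix.of fun i j => b j i) * rectDiagonal K D (singularValue X) := by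
    ext i j
    have h1 : (X * (Matrix.of fun i j => v j i)) i j = T (v j) i := by
      simp [hT, Matrix.mul_apply, Matrix.toLpLin_apply, Matrix.mulVec, dotProduct]
    have h0 : singularValue X j = 0 → T (v j) = 0 := fun h => by
      rw [← inner_self_eq_zero (𝕜 := ℝ), hinner, if_pos rfl, h]; simp
    rw [h1, Matrix.mul_apply]
    by_cases hj : j.val < K
    · rw [Finset.sum_eq_single ⟨j, hj⟩]
      · simp only [rectDiagonal, Matrix.of_apply, if_true]
        by_cases h : singularValue X j = 0
        · simp [h, h0 h]
        · rw [hb ⟨j, hj⟩ h]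
          simp [f]
          field_simp
      · intro k _ hk
        have : k.val ≠ j.val := fun h => hk (Fin.ext h)
        simp [rectDiagonal, this]
      · simp
    · rw [h0 (singularValue_eq_zero_of_le_left X (not_lt.1 hj))]
      symm
      refine Finset.sum_eq_zero fun k _ => ?_
      have : k.val ≠ j.val := by omega
      simp [rectDiagonal, this]
  rw [← hXV, Matrix.mul_assoc, hV, Matrix.mul_one]

theorem rectDiagonal_mul_transpose (X : Matrix (Fin K) (Fin D) ℝ) :
    rectDiagonal K D (singularValue X) * (rectDiagonal K D (singularValue X))ᵀ =
      Matrix.diagonal fun i : Fin K => singularValue X i ^ 2 := by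
  ext i j
  rw [Matrix.mul_apply, Matrix.diagonal_apply]
  simp only [rectDiagonal, Matrix.transpose_apply, Matrix.of_apply]
  by_cases hi : i.val < D
  · rw [Finset.sum_eq_single ⟨i, hi⟩]
    · by_cases hij : i = j
      · subst hij; simp [sq]
      · have : j.val ≠ i.val := fun h => hij (Fin.ext h.symm)
        simp [hij, this]
    · intro k _ hk
      have : i.val ≠ k.val := fun h => hk (Fin.ext h.symm)
      simp [this]
    · simp
  · rw [singularValue_eq_zero_of_le_right X (not_lt.1 hi)]
    simp

theorem IsSVD.mul_transpose_mulVec_col {X : Matrix (Fin K) (Fin D) ℝ}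
    {U : Matrix (Fin K) (Fin K) ℝ} {V : Matrix (Fin D) (Fin D) ℝ} (h : IsSVD X U V) (j : Fin K) :
    X *ᵥ (Xᵀ *ᵥ U.col j) = singularValue X j ^ 2 • U.col j := by
  have hU := (Matrix.mem_orthogonalGroup_iff' (Fin K) ℝ).1 h.left_orthogonal
  have hV := (Matrix.mem_orthogonalGroup_iff' (Fin D) ℝ).1 h.right_orthogonal
  set L := rectDiagonal K D (singularValue X) with hL
  have e : X * Xᵀ * U = U * Matrix.diagonal fun i : Fin K => singularValue X i ^ 2 := by
    calc X * Xᵀ * U = U * L * Vᵀ * (U * L * Vᵀ)ᵀ * U := by rw [← h.eq_mul]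
      _ = U * L * (Vᵀ * V) * Lᵀ * (Uᵀ * U) := by
          simp only [Matrix.transpose_mul, Matrix.transpose_transpose, Matrix.mul_assoc]
      _ = _ := by
          rw [hU, hV, Matrix.mul_one, Matrix.mul_one, Matrix.mul_assoc, rectDiagonal_mul_transpose]
  ext i
  have := congrFun (congrFun e i) j
  rw [Matrix.mul_diagonal] at this
  rw [Matrix.mulVec_mulVec]
  simpa [Matrix.mul_apply, Matrix.mulVec, dotProduct, mul_comm] using this

/-- The linear map `x ↦ Xᵀ x` of Euclidean spaces. -/
noncomputable def transposeCLM (X : Matrix (Fin K) (Fin D) ℝ) :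
    EuclideanSpace ℝ (Fin K) →L[ℝ] EuclideanSpace ℝ (Fin D) :=
  (Matrix.toEuclideanLin Xᵀ).toContinuousLinearMap

/-- The linear map `x ↦ X Xᵀ x` of Euclidean space. -/
noncomputable def gramCLM (X : Matrix (Fin K) (Fin D) ℝ) :
    EuclideanSpace ℝ (Fin K) →L[ℝ] EuclideanSpace ℝ (Fin K) :=
  ContinuousLinearMap.adjoint (transposeCLM X) ∘L transposeCLM X

theorem adjoint_transposeCLM (X : Matrix (Fin K) (Fin D) ℝ) :
    ContinuousLinearMap.adjoint (transposeCLM X) =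
      (Matrix.toEuclideanLin X).toContinuousLinearMap := by
  symm
  rw [ContinuousLinearMap.eq_adjoint_iff]
  intro x y
  simp only [transposeCLM, LinearMap.coe_toContinuousLinearMap', Matrix.toLpLin_apply,
    EuclideanSpace.inner_eq_star_dotProduct, star_trivial]
  rw [Matrix.mulVec_transpose, ← Matrix.dotProduct_mulVec]
theorem IsSVD.isSortedEigenbasis {X : Matrix (Fin K) (Fin D) ℝ}
    {U : Matrix (Fin K) (Fin K) ℝ} {V : Matrix (Fin D) (Fin D) ℝ} (h : IsSVD X U V)
    {b : OrthonormalBasis (Fin K) ℝ (EuclideanSpace ℝ (Fin K))}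
    (hb : ∀ j, b j = WithLp.toLp 2 (U.col j)) :
    IsSortedEigenbasis (gramCLM X) b fun j => singularValue X j ^ 2 where
  apply_eq j := by
    have := congrArg (WithLp.toLp 2) (h.mul_transpose_mulVec_col j)
    rw [hb, gramCLM, adjoint_transposeCLM]
    simpa [transposeCLM] using this
  antitone i j hij := pow_le_pow_left₀ (singularValue_nonneg X j) (singularValue_antitone X hij) 2
  nonneg j := sq_nonneg _

/-- Submultiplicativity of the Frobenius norm, with the vector viewed as a one-column matrix. -/
theorem norm_transposeCLM_le_frobenius (E : Matrix (Fin K) (Fin D) ℝ) : ‖transposeCLM E‖ ≤ ‖E‖ := by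
  refine ContinuousLinearMap.opNorm_le_bound _ (norm_nonneg _) fun x => ?_
  have h := Matrix.frobenius_norm_mul Eᵀ (Matrix.replicateCol Unit x.ofLp)
  rw [Matrix.frobenius_norm_transpose, Matrix.frobenius_norm_replicateCol,
    ← Matrix.replicateCol_mulVec, Matrix.frobenius_norm_replicateCol] at h
  exact h

/-- The eigenbasis bounds $\|XX'\|$ by $\lambda_1^2$ (the tail from index $0$ is the whole space),
and $\|XX'\|=\|X'\|^2$. -/
theorem norm_transposeCLM_le_singularValue (X : Matrix (Fin K) (Fin D) ℝ) :
    ‖transposeCLM X‖ ≤ singularValue X 0 := by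
  obtain ⟨U, V, h⟩ := exists_isSVD X
  obtain ⟨b, hb⟩ := exists_orthonormalBasis_eq_col h.left_orthogonal
  have hg : ‖gramCLM X‖ ≤ singularValue X 0 ^ 2 :=
    ContinuousLinearMap.opNorm_le_bound _ (sq_nonneg _) fun x =>
      (h.isSortedEigenbasis hb).norm_apply_le (d := 0) ((mem_tailSpan_iff b).2 (by simp))
  rw [gramCLM, ContinuousLinearMap.norm_adjoint_comp_self, ← sq] at hg
  exact le_of_sq_le_sq hg (singularValue_nonneg X 0)

theorem norm_gramCLM_sub_le (X E : Matrix (Fin K) (Fin D) ℝ) {ε : ℝ} (hε : 0 ≤ ε) :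
    ‖gramCLM X - gramCLM (X + ε • E)‖ ≤ 2 * ε * singularValue X 0 * ‖E‖ + ε ^ 2 * ‖E‖ ^ 2 := by
  set T := transposeCLM X with hT
  set S := transposeCLM E with hS
  have hTX := norm_transposeCLM_le_singularValue X
  have hSE := norm_transposeCLM_le_frobenius E
  rw [← hT] at hTX
  rw [← hS] at hSE
  have hadd : transposeCLM (X + ε • E) = T + ε • S := by
    ext1 x
    simp [hT, hS, transposeCLM]
  have e : gramCLM X - gramCLM (X + ε • E) =
      -(ε • (ContinuousLinearMap.adjoint T ∘L S) + ε • (ContinuousLinearMap.adjoint S ∘L T) +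
        ε ^ 2 • (ContinuousLinearMap.adjoint S ∘L S)) := by
    ext1 x
    simp only [gramCLM, hadd, ← hT, map_add, map_smulₛₗ]
    simp
    module
  have hadj : ∀ R : EuclideanSpace ℝ (Fin K) →L[ℝ] EuclideanSpace ℝ (Fin D),
    ‖ContinuousLinearMap.adjoint R‖ = ‖R‖ := fun R => LinearIsometryEquiv.norm_map _ R
  have hs0 := singularValue_nonneg X 0
  rw [e, norm_neg]
  refine (norm_add₃_le).trans ?_
  rw [norm_smul, norm_smul, norm_smul, Real.norm_of_nonneg hε, Real.norm_of_nonneg (sq_nonneg ε)]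
  have h1 : ‖ContinuousLinearMap.adjoint T ∘L S‖ ≤ singularValue X 0 * ‖E‖ := by
    refine (ContinuousLinearMap.opNorm_comp_le _ _).trans ?_
    rw [hadj]; gcongr
  have h2 : ‖ContinuousLinearMap.adjoint S ∘L T‖ ≤ ‖E‖ * singularValue X 0 := by
    refine (ContinuousLinearMap.opNorm_comp_le _ _).trans ?_
    rw [hadj]; gcongr
  have h3 : ‖ContinuousLinearMap.adjoint S ∘L S‖ ≤ ‖E‖ * ‖E‖ := by
    refine (ContinuousLinearMap.opNorm_comp_le _ _).trans ?_
    rw [hadj]; gcongr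
  calc _ ≤ ε * (singularValue X 0 * ‖E‖) + ε * (‖E‖ * singularValue X 0)
        + ε ^ 2 * (‖E‖ * ‖E‖) := by gcongr
    _ = _ := by ring

end SingularValueDecomposition

/-! ### Weight vectors as minimal norm vectors, and their perturbation -/

section WeightVector

variable {K D : ℕ}

theorem lastColumnsSpan_eq_tailSpan {U : Matrix (Fin K) (Fin K) ℝ}
    {b : OrthonormalBasis (Fin K) ℝ (EuclideanSpace ℝ (Fin K))}
    (hb : ∀ j, b j = WithLp.toLp 2 (U.col j)) (d : ℕ) : lastColumnsSpan d U = tailSpan b d := by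
  rw [lastColumnsSpan, tailSpan, Set.image_congr fun j _ => (hb j).symm]

theorem inner_toLp_one (w : EuclideanSpace ℝ (Fin K)) :
    inner ℝ (WithLp.toLp 2 (1 : Fin K → ℝ)) w = ∑ j, w j := by
  simp [PiLp.inner_apply]

/-- A weight vector may come from any decomposition; the strict gap gives all of them the same
feasible set, hence the same minimizer. -/
theorem isWeightVector_iff {X : Matrix (Fin K) (Fin D) ℝ} {U : Matrix (Fin K) (Fin K) ℝ}
    {V : Matrix (Fin D) (Fin D) ℝ} (h : IsSVD X U V)
    {b : OrthonormalBasis (Fin K) ℝ (EuclideanSpace ℝ (Fin K))}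
    (hb : ∀ j, b j = WithLp.toLp 2 (U.col j)) {d : ℕ}
    (hgap : singularValue X (d + 1) < singularValue X d)
    (hne : (tailSpan b (d + 1)).starProjection (WithLp.toLp 2 1) ≠ 0)
    {w : EuclideanSpace ℝ (Fin K)} :
    IsWeightVector (d + 1) X w ↔ w = minNormVector (tailSpan b (d + 1)) (WithLp.toLp 2 1) := by
  have hadm : ∀ {U' V'}, IsSVD X U' V' → admissibleWeights (d + 1) U' =
      {w | w ∈ tailSpan b (d + 1) ∧ inner ℝ (WithLp.toLp 2 (1 : Fin K → ℝ)) w = 1} := by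
    intro U' V' h'
    obtain ⟨b', hb'⟩ := exists_orthonormalBasis_eq_col h'.left_orthogonal
    ext w
    rw [admissibleWeights, lastColumnsSpan_eq_tailSpan hb',
      (h'.isSortedEigenbasis hb').tailSpan_eq (h.isSortedEigenbasis hb)
        (pow_lt_pow_left₀ hgap (singularValue_nonneg _ _) two_ne_zero)]
    simp only [inner_toLp_one]
  rw [← isMinOn_iff_eq_minNormVector hne]
  constructor
  · rintro ⟨U', V', h', hw⟩
    rw [hadm h'] at hw
    exact hw
  · intro hw
    refine ⟨U, V, h, ?_⟩
    rw [hadm h]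
    exact hw

theorem norm_toLp_one_sq : ‖(WithLp.toLp 2 (1 : Fin K → ℝ) : EuclideanSpace ℝ (Fin K))‖ ^ 2 = K := by
  simp [EuclideanSpace.norm_sq_eq]

/-- The quadratic form of `U₁ U₁ᵀ` is the squared norm of the projection onto the head. -/
theorem one_dotProduct_firstColumns_mulVec {U : Matrix (Fin K) (Fin K) ℝ}
    {b : OrthonormalBasis (Fin K) ℝ (EuclideanSpace ℝ (Fin K))}
    (hb : ∀ j, b j = WithLp.toLp 2 (U.col j)) {d : ℕ} (hd : d ≤ K) :
    ((1 : Fin K → ℝ) ⬝ᵥ ((firstColumns hd U * (firstColumns hd U)ᵀ) *ᵥ 1)) =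
      K - ‖(tailSpan b d).starProjection (WithLp.toLp 2 1)‖ ^ 2 := by
  set e : EuclideanSpace ℝ (Fin K) := WithLp.toLp 2 (1 : Fin K → ℝ) with he
  set p := (tailSpan b d).starProjection e with hp
  -- The quadratic form is the squared norm of the complementary component $e-p$, computed in
  -- coordinates in `hq` and `hl`; Pythagoras converts it to $\|p\|^2$.
  have hpy : ‖e‖ ^ 2 = ‖p‖ ^ 2 + ‖e - p‖ ^ 2 := by
    have := norm_add_sq_eq_norm_sq_add_norm_sq_real
      (Submodule.starProjection_inner_eq_zero e p (Submodule.starProjection_apply_mem _ _))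
    rw [sub_add_cancel, ← hp] at this
    nlinarith [this]
  have hq : ‖e - p‖ ^ 2 = ∑ j : Fin d, inner ℝ (b (Fin.castLE hd j)) e ^ 2 := by
    have hmem := (mem_tailSpan_orthogonal_iff b).1
      (Submodule.sub_starProjection_mem_orthogonal (K := tailSpan b d) e)
    have hmem' := (mem_tailSpan_iff b).1 (Submodule.starProjection_apply_mem (tailSpan b d) e)
    rw [← b.repr.norm_map, EuclideanSpace.norm_sq_eq]
    symm
    refine Finset.sum_of_injOn (Fin.castLE hd) (Fin.castLE_injective hd).injOn (by simp) ?_ ?_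
    · intro j _ hj
      have : d ≤ j.val := by
        by_contra hc
        exact hj ⟨⟨j, not_le.1 hc⟩, by simp, rfl⟩
      rw [hmem j this]; simp
    · intro j _
      have := hmem' (Fin.castLE hd j) (by simp)
      rw [map_sub, PiLp.sub_apply, this, sub_zero, b.repr_apply_apply, Real.norm_eq_abs, sq_abs]
  have hl : ((1 : Fin K → ℝ) ⬝ᵥ ((firstColumns hd U * (firstColumns hd U)ᵀ) *ᵥ 1)) =
      ∑ j : Fin d, inner ℝ (b (Fin.castLE hd j)) e ^ 2 := by
    rw [← Matrix.mulVec_mulVec, Matrix.dotProduct_mulVec, ← Matrix.mulVec_transpose, dotProduct]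
    refine Finset.sum_congr rfl fun j _ => ?_
    rw [real_inner_comm, he, inner_toLp_one, hb, sq]
    simp [firstColumns, Matrix.mulVec, dotProduct]
  rw [hl, ← hq, ← norm_toLp_one_sq (K := K)]
  linarith

/-- Perturbation bound for minimal norm vectors in terms of the distance `δ` of the projections. -/
theorem norm_minNormVector_sub_le {H : Type*} [NormedAddCommGroup H] [InnerProductSpace ℝ H]
    {N M : Submodule ℝ H} [N.HasOrthogonalProjection] [M.HasOrthogonalProjection] {e : H}
    {s δ : ℝ} (hs : 0 < s) (hδs : δ < s) (he : 1 ≤ ‖e‖) (hN : s * ‖e‖ ≤ ‖N.starProjection e‖)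
    (hδ : ‖N.starProjection - M.starProjection‖ ≤ δ) :
    M.starProjection e ≠ 0 ∧
      ‖minNormVector N e - minNormVector M e‖ ≤ δ / (s * (s - δ)) := by
  have hdiff : ‖N.starProjection e - M.starProjection e‖ ≤ δ * ‖e‖ := by
    refine ((N.starProjection - M.starProjection).le_opNorm e).trans ?_
    gcongr
  have hδ0 : 0 ≤ δ := (norm_nonneg _).trans hδ
  have hM : (s - δ) * ‖e‖ ≤ ‖M.starProjection e‖ := by
    have := norm_le_norm_add_norm_sub' (N.starProjection e) (M.starProjection e)
    linarith
  have he0 : 0 < ‖e‖ := one_pos.trans_le he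
  have hsδ : 0 < s - δ := sub_pos.2 hδs
  have hM0 : M.starProjection e ≠ 0 := norm_pos_iff.1 ((by positivity : 0 < (s - δ) * ‖e‖).trans_le hM)
  have hN0 : N.starProjection e ≠ 0 := norm_pos_iff.1 ((by positivity : 0 < s * ‖e‖).trans_le hN)
  refine ⟨hM0, ?_⟩
  rw [norm_minNormVector_sub hN0 hM0]
  calc _ ≤ δ * ‖e‖ / ((s * ‖e‖) * ((s - δ) * ‖e‖)) := by gcongr
    _ = δ / (s * (s - δ)) / ‖e‖ := by field_simp
    -- The gain $1/\|e\|\le1$ is discarded.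
    _ ≤ _ := div_le_self (by positivity) he

end WeightVector

/-! ### The main theorem: tracking the constants -/

theorem theorem1 {K D d : ℕ} (hd : 1 ≤ d) (hdK : d < K)
    (X E : Matrix (Fin K) (Fin D) ℝ) (hE : ‖E‖ = 1)
    (U : Matrix (Fin K) (Fin K) ℝ) (V : Matrix (Fin D) (Fin D) ℝ) (hX : IsSVD X U V)
    (α ε : ℝ)
    (hA1 : singularValue X d < min (singularValue X (d - 1) ^ 2) (singularValue X (d - 1) / 72))
    (hα : α < 1)
    (hA2 : (1 / (K : ℝ)) *
      ((1 : Fin K → ℝ) ⬝ᵥ ((firstColumns hdK.le U * (firstColumns hdK.le U)ᵀ) *ᵥ 1)) < α)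
    (hX1 : singularValue X 0 < 1)
    (hε0 : 0 < ε)
    (hε : ε < min (singularValue X (d - 1) ^ 4 / 72) (singularValue X (d - 1) ^ 2 * (1 - α) / 72)) :
    (∃! w, IsWeightVector d X w) ∧ (∃! w', IsWeightVector d (X + ε • E) w') ∧
      ∀ w w' : EuclideanSpace ℝ (Fin K),
        IsWeightVector d X w → IsWeightVector d (X + ε • E) w' →
          ‖w - w'‖ < 20 * ε / (singularValue X (d - 1) ^ 2 * (1 - α)) := by
  -- Indices start at zero: with $d=m+1$, $\lambda_d$ and $\lambda_{d+1}$ have indices $m$ and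
  -- $m+1$, and the tail starts at $m+1$.
  obtain ⟨m, rfl⟩ : ∃ m, d = m + 1 := ⟨d - 1, by omega⟩
  simp only [Nat.add_sub_cancel] at *
  obtain ⟨U', V', hX'⟩ := exists_isSVD (X + ε • E)
  obtain ⟨u, hu⟩ := exists_orthonormalBasis_eq_col hX.left_orthogonal
  obtain ⟨v, hv⟩ := exists_orthonormalBasis_eq_col hX'.left_orthogonal
  have hA := hX.isSortedEigenbasis hu
  have hB := hX'.isSortedEigenbasis hv
  have hw := norm_gramCLM_sub_le X E hε0.le
  have weyl₁ := hA.le_add_norm_sub hB hdK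
  have weyl₂ := hB.le_add_norm_sub hA (show m < K by omega)
  have hproj := fun g hg h₁ h₂ => hA.norm_starProjection_sub_le hB (d := m) (g := g) hg h₁ h₂
  rw [norm_sub_rev] at weyl₂
  have ha1 : singularValue X m < 1 := (singularValue_antitone X (Nat.zero_le m)).trans_lt hX1
  have hs0 := singularValue_nonneg X 0
  have hb0 := singularValue_nonneg X (m + 1)
  have hb0' := singularValue_nonneg (X + ε • E) (m + 1)
  have ha0' := singularValue_nonneg (X + ε • E) m
  rw [hE] at hw
  rw [lt_min_iff] at hA1 hε
  rw [one_dotProduct_firstColumns_mulVec hu] at hA2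
  set P := (tailSpan u (m + 1)).starProjection with hP
  set e : EuclideanSpace ℝ (Fin K) := WithLp.toLp 2 (1 : Fin K → ℝ) with he
  set δ₀ := ‖gramCLM X - gramCLM (X + ε • E)‖ with hδ₀
  set a := singularValue X m with ha
  set b := singularValue X (m + 1) with hb
  have ha0 : 0 < a := by linarith [hA1.2]
  have hK : (1 : ℝ) ≤ K := by exact_mod_cast (show 1 ≤ K by omega)
  have he2 : ‖e‖ ^ 2 = K := norm_toLp_one_sq
  have he1 : 1 ≤ ‖e‖ := (one_le_sq_iff₀ (norm_nonneg e)).1 (he2 ▸ hK)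
  have ha2 : a ^ 2 < 1 := pow_lt_one₀ ha0.le ha1 two_ne_zero
  have ha4 : a ^ 4 ≤ a ^ 2 := pow_le_pow_of_le_one ha0.le ha1.le (by norm_num)
  have hδ : δ₀ ≤ 3 * ε := by
    have h₁ : ε * singularValue X 0 ≤ ε * 1 := by gcongr
    have h₂ : ε * ε ≤ ε * 1 := by gcongr; linarith [hε.1]
    linarith
  have hb2 : b ^ 2 ≤ (a / 72) ^ 2 := pow_le_pow_left₀ hb0 hA1.2.le 2
  have hδa : δ₀ ≤ a ^ 2 / 24 := by linarith [hε.1]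
  -- By Weyl both mixed gaps are at least $a^2-b^2-\delta_0\ge
  -- a^2(1-1/72^2-1/24)>\tfrac{19}{20}a^2$.
  have hproj := hproj (19 / 20 * a ^ 2) (by positivity) (by linarith) (by linarith)
  -- The quadratic form in (A2) is nonnegative. Positivity of $\alpha$ gives $s=\sqrt{1-\alpha}<1$,
  -- hence $s^2\le s$ in `hδs`.
  have hα0 : 0 < α := by
    refine lt_of_le_of_lt ?_ hA2
    have : ‖P e‖ ≤ ‖e‖ := Submodule.norm_starProjection_apply_le _ e
    have : ‖P e‖ ^ 2 ≤ ‖e‖ ^ 2 := by gcongr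
    rw [← he2]
    exact mul_nonneg (by positivity) (by linarith)
  have hPe : (1 - α) * ‖e‖ ^ 2 ≤ ‖P e‖ ^ 2 := by
    rw [one_div, inv_mul_lt_iff₀ (by linarith)] at hA2
    rw [he2]; linarith
  set s := √(1 - α) with hs
  have hs_sq : s ^ 2 = 1 - α := Real.sq_sqrt (by linarith)
  have hs_pos : 0 < s := Real.sqrt_pos.2 (by linarith)
  have hs_lt : s < 1 := (sq_lt_one_iff₀ hs_pos.le).1 (by linarith)
  have hN : s * ‖e‖ ≤ ‖P e‖ := by
    refine le_of_sq_le_sq ?_ (norm_nonneg _)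
    rwa [mul_pow, hs_sq]
  -- From $\delta_0\le3\varepsilon$ and $6\cdot\tfrac{20}{19}<6.5$.
  have hδ' : 2 * δ₀ / (19 / 20 * a ^ 2) ≤ 6.5 * ε / a ^ 2 := by
    rw [div_le_div_iff₀ (by positivity) (by positivity)]
    have h₁ := mul_le_mul_of_nonneg_right hδ (sq_nonneg a)
    have h₂ : 0 ≤ ε * a ^ 2 := by positivity
    linarith
  -- The bound $\varepsilon<a^2s^2/72$ suffices because $6.5/72<1/10$; then
  -- $s-\delta\ge\tfrac{9}{10}s$ in the final estimate.
  have hδs : 6.5 * ε / a ^ 2 ≤ s / 10 := by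
    rw [div_le_iff₀ (by positivity)]
    have : s ^ 2 ≤ s := pow_le_of_le_one hs_pos.le hs_lt.le two_ne_zero
    have := mul_le_mul_of_nonneg_left this (sq_nonneg a)
    rw [hs_sq] at this
    linarith [hε.2]
  obtain ⟨hMe, hbound⟩ := norm_minNormVector_sub_le hs_pos
    (show 6.5 * ε / a ^ 2 < s by linarith) he1 hN (hproj.trans hδ')
  have hNe : P e ≠ 0 := norm_pos_iff.1 ((by positivity : 0 < s * ‖e‖).trans_le hN)
  -- Weyl applied to both eigenvalues leaves a squared gap of at least $a^2-b^2-2\delta_0>0$.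
  have hgap : singularValue (X + ε • E) (m + 1) < singularValue (X + ε • E) m :=
    lt_of_pow_lt_pow_left₀ 2 ha0' (by linarith [pow_pos ha0 2])
  have iff₁ := fun w => isWeightVector_iff hX hu (d := m) (w := w) (by linarith) hNe
  have iff₂ := fun w => isWeightVector_iff hX' hv (d := m) (w := w) hgap hMe
  refine ⟨⟨_, (iff₁ _).2 rfl, fun w hw => (iff₁ w).1 hw⟩,
    ⟨_, (iff₂ _).2 rfl, fun w hw => (iff₂ w).1 hw⟩, fun w w' h h' => ?_⟩
  rw [(iff₁ w).1 h, (iff₂ w').1 h']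
  refine hbound.trans_lt ?_
  calc _ ≤ 6.5 * ε / a ^ 2 / (s * (9 / 10 * s)) := by gcongr; linarith
    _ = (6.5 / (9 / 10)) * ε / (a ^ 2 * s ^ 2) := by field_simp
    _ < 20 * ε / (a ^ 2 * s ^ 2) := by gcongr; norm_num
    _ = _ := by rw [hs_sq]
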